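/- **Model.** A seller has $N$ items and in each of $T$ rounds may offer at most $K$ of them. In round $t$ item $i\in[N]=\{1,\dots,N\}$ has a feature vector $x_{ti}\in\mathbb R^d$. The seller chooses an assortment $S_t\subseteq[N]$ with $|S_t|\le K$ and prices $p_t\in\mathbb R^N$, and the buyer chooses $i_t\in S_t\cup\{0\}$ ($0$ means no purchase) according to the multinomial logit model $$q_t(i\mid S,p)=\frac{e^{u_{ti}(p_i)}}{1+\sum_{j\in S}e^{u_{tj}(p_j)}}\ (i\in S),\qquad q_t(0\mid S,p)=\frac{1}{1+\sum_{j\in S}e^{u_{tj}(p_j)}},\qquad u_{ti}(p)=\langle\psi^*,x_{ti}\rangle-\langle\phi^*,x_{ti}\rangle\,p,$$ where $\psi^*,\phi^*\in\mathbb R^d$ are unknown to the seller. The expected revenue is $R_t(S,p)=\sum_{i\in S}p_i\,q_t(i\mid S,p)$. A policy $\pi=(\pi^t)_{t\le T}$ is a sequence of functions, where $\pi^t$ maps the history $(\{x_{\tau i}\}_{i},S_\tau,p_\tau,i_\tau)_{\tau<t}$ and the current features $\{x_{ti}\}_i$ to the action $(S_t,p_t)$. Its regret is $$\mathcal R_T(\pi)=\mathbb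 E\Big[\sum_{t=1}^T R_t(S_t^*,p_t^*)-\sum_{t=1}^T R_t(S_t,p_t)\Big],$$ where $(S_t^*,p_t^*)$ maximizes $R_t$ over all $S\subseteq[N]$ with $|S|\le K$ and all $p\in\mathbb R^N$, and the expectation is over the buyers' choices. **Theorem 3.** There are universal constants $c_1,c_2,C_3>0$ such that the following holds. Let $0<L_0<1$ and let $d\ge 1$ be divisible by $4$. Then there is $T_0=T_0(d,L_0)$ such that for every $K\ge1$ there is a number of items $N$ with $c_1K2^d\le N\le c_2K2^d$ with the following property: for every $T\ge T_0$ and every policy $\pi$ for $N$ items, dimension $d$, maximum assortment size $K$ and horizon $T$, there is an instance (features $x_{ti}$ and parameters $\psi^*,\phi^*$) with $\|x_{ti}\|\le1$ and $\langle\phi^*,x_{ti}\rangle\ge L_0$ for all $t\in[T]$ and $i\in[N]$, and with $\|(\psi^*;\phi^*)\|\le1$, on which an optimal action $(S_t^*,p_t^*)$ exists in every round and $$\mathcal R_T(\pi)\ \ge\ C_3\,\frac{d\sqrt T}{L_0}.$$ -/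

import Mathlib

namespace AssortmentPricing

/-- The space `ℝ^d` of item features, with the Euclidean norm. -/
abbrev Feature (d : ℕ) : Type := EuclideanSpace ℝ (Fin d)

/-- An action of the seller: an assortment of at most `K` of the `N` items, and a price vector. -/
structure Action (N K : ℕ) where
  assortment : Finset (Fin N)
  card_le : assortment.card ≤ K
  price : Fin N → ℝ

/-- What the seller has seen once a round is over: the features of all items, the action that was
taken, and the buyer's choice (`none` is the no-purchase option). -/
structure Observation (N d K : ℕ) where
  features : Fin N → Feature d
  action : Action N K
  choice : Option (Fin N)

/-- A policy for `T` rounds: in every round, a function of the history of the earlier rounds and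
of the current features of the items, with values in the set of actions. -/
abbrev Policy (N d K T : ℕ) : Type :=
  (t : Fin T) → (Fin t → Observation N d K) → (Fin N → Feature d) → Action N K

/-- A problem instance: the features of the items in all rounds and the parameters of the buyers'
utility. -/
structure Instance (N d T : ℕ) where
  x : Fin T → Fin N → Feature d
  ψ : Feature d
  φ : Feature d

noncomputable section

variable {N d K T : ℕ}

/-- Utility of item `i` in round `t` at price `p`. -/
def Instance.utility (I : Instance N d T) (t : Fin T) (i : Fin N) (p : ℝ) : ℝ :=
  inner ℝ I.ψ (I.x t i) - inner ℝ I.φ (I.x t i) * p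

/-- Multinomial logit probability of the buyer's choice in round `t`, when `a` is offered. -/
def Instance.choiceProb (I : Instance N d T) (t : Fin T) (a : Action N K) :
    Option (Fin N) → ℝ
  | none => 1 / (1 + ∑ j ∈ a.assortment, Real.exp (I.utility t j (a.price j)))
  | some i =>
      if i ∈ a.assortment then
        Real.exp (I.utility t i (a.price i)) /
          (1 + ∑ j ∈ a.assortment, Real.exp (I.utility t j (a.price j)))
      else 0

/-- Expected revenue of the action `a` in round `t`. -/
def Instance.revenue (I : Instance N d T) (t : Fin T) (a : Action N K) : ℝ :=
  ∑ i ∈ a.assortment, a.price i * I.choiceProb t a (some i)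

/-- The action `a` maximizes the expected revenue in round `t` over all assortments of at most `K`
items and all price vectors. -/
def Instance.IsOptimal (I : Instance N d T) (t : Fin T) (a : Action N K) : Prop :=
  ∀ b : Action N K, I.revenue t b ≤ I.revenue t a

/-- The history of the first `t` rounds when the policy `π` is used and the buyers' choices are
`c`. -/
def Instance.history (I : Instance N d T) (π : Policy N d K T) (c : Fin T → Option (Fin N)) :
    (t : ℕ) → t ≤ T → Fin t → Observation N d K
  | 0, _ => Fin.elim0
  | t + 1, h =>
      let H := Instance.history I π c t (Nat.le_of_succ_le h)
      Fin.snoc (α := fun _ => Observation N d K) H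
        { features := I.x ⟨t, h⟩
          action := π ⟨t, h⟩ H (I.x ⟨t, h⟩)
          choice := c ⟨t, h⟩ }

/-- The action of the policy `π` in round `t` when the buyers' choices are `c` (only the choices
before round `t` matter). -/
def Instance.actionAt (I : Instance N d T) (π : Policy N d K T) (c : Fin T → Option (Fin N))
    (t : Fin T) : Action N K :=
  π t (I.history π c t t.isLt.le) (I.x t)

/-- The probability that the buyers' choices are `c` when the policy `π` is used. -/
def Instance.pathProb (I : Instance N d T) (π : Policy N d K T) (c : Fin T → Option (Fin N)) : ℝ :=
  ∏ t, I.choiceProb t (I.actionAt π c t) (c t)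

/-- The expected regret of the policy `π` over the `T` rounds, relative to the sequence `best` of
actions. -/
def Instance.regret (I : Instance N d T) (best : Fin T → Action N K) (π : Policy N d K T) : ℝ :=
  ∑ c : Fin T → Option (Fin N), I.pathProb π c *
    (∑ t, I.revenue t (best t) - ∑ t, I.revenue t (I.actionAt π c t))

/-- The features and the parameters are in the respective unit balls, and the price sensitivity of
every item in every round is at least `L₀`. -/
structure Instance.Admissible (I : Instance N d T) (L₀ : ℝ) : Prop where
  norm_x_le : ∀ t i, ‖I.x t i‖ ≤ 1
  norm_param_le : ‖WithLp.toLp 2 (I.ψ, I.φ)‖ ≤ 1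
  sensitivity : ∀ t i, L₀ ≤ inner ℝ I.φ (I.x t i)

end

end AssortmentPricing

/-!
The lower bound is Assouad's method on a family of instances in which only the parameter `ψ` is
hidden. Write `m = d - 1`, and let there be `K` items for each sign vector `s ∈ {±1}^m`, with
feature `(√L₀, √δ s)`, where `δ = 1 / √T`; the buyer has `φ = (√L₀, 0)` and `ψ = (0, √δ v)` for a
hidden sign vector `v` (`hardInstance`). Every item has price sensitivity exactly `L₀`, and
intrinsic utility `δ ⟨v, s⟩`. For `T ≥ (2 m / (1 - L₀))²`, independently of `K`, the vectors lie in
the unit balls.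

*Cost of a wrong sign.* With common price sensitivity `β`, an assortment of total attraction `Y` has
best revenue `r / β`, where `r e^r = Y / e` (`Instance.mul_revenue_le`). The optimum offers the `K`
items with `s = v`, and since `r ↦ r e^r` is convex, any other action loses at least `δ / (6 L₀)`
times the sum over coordinates of the fraction of slots in which that sign of `v` is missed, at any
prices (`exists_optimal_hardInstance`).

*Indistinguishability.* Flipping one sign of `v` changes all utilities by at most `2 δ` at every
price. Then the choice laws in one round have Hellinger affinity at least
`1 / cosh δ ≥ exp (-δ² / 2)`, by a reverse Cauchy–Schwarz inequality with no dependence on the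
number of alternatives. Affinities multiply along the rounds even for adaptive policies
(`pow_le_sum_prod`), so the path laws overlap in mass at least `exp (-T δ²) / 2 = 1 / (2 e)`
(`Instance.exp_le_sum_min_pathProb`).

Hence, for each of the `m` coordinates, the expected number of rounds with a miss is of order `T`
on average over `v`. Some `v` has regret of order `(δ / L₀) m T`, which is of order `d √T / L₀`.
-/

namespace AssortmentPricing

noncomputable section

/-! ### Revenue when all items have the same price sensitivity -/

lemma exists_mul_exp_eq {c : ℝ} (hc : 0 ≤ c) : ∃ x : ℝ, 0 ≤ x ∧ x * Real.exp x = c := by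
  have hcont : ContinuousOn (fun x : ℝ => x * Real.exp x) (Set.Icc 0 c) := by fun_prop
  have hmem : c ∈ Set.Icc ((0 : ℝ) * Real.exp 0) (c * Real.exp c) :=
    ⟨by simpa using hc, by nlinarith [Real.add_one_le_exp c]⟩
  obtain ⟨x, hx, hxc⟩ := intermediate_value_Icc hc hcont hmem
  exact ⟨x, hx.1, hxc⟩

/-- A linear lower bound for `y * exp y` around `y = x`, in the form in which it turns a relative
loss `1 - ρ` of attraction into a loss of revenue. -/
lemma mul_mul_exp_le {x ρ : ℝ} (hx : 0 ≤ x) (hρ : 0 ≤ ρ) :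
    ρ * (x * Real.exp x) ≤
      (x - (1 - ρ) * (x / (1 + x))) * Real.exp (x - (1 - ρ) * (x / (1 + x))) := by
  set h := (1 - ρ) * (x / (1 + x)) with hh
  have hmul : h * (1 + x) = (1 - ρ) * x := by
    rw [hh]; field_simp
  have hneg : 0 ≤ x - h := by
    have hq0 : 0 ≤ x / (1 + x) := by positivity
    have hqx : x / (1 + x) ≤ x := div_le_self hx (by linarith)
    nlinarith [mul_nonneg hρ hq0]
  have hexp : Real.exp (x - h) = Real.exp x * Real.exp (-h) := by
    rw [← Real.exp_add]; ring_nf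
  have h1 : (x - h) * (1 - h) ≤ (x - h) * Real.exp (-h) :=
    mul_le_mul_of_nonneg_left (by linarith [Real.add_one_le_exp (-h)]) hneg
  have h2 : ρ * x ≤ (x - h) * Real.exp (-h) := by nlinarith [sq_nonneg h]
  rw [hexp]
  nlinarith [mul_le_mul_of_nonneg_left h2 (Real.exp_pos x).le]

variable {N d K T m : ℕ}

lemma Instance.one_add_sum_exp_pos (I : Instance N d T) (t : Fin T) (a : Action N K) :
    0 < 1 + ∑ j ∈ a.assortment, Real.exp (I.utility t j (a.price j)) := by
  have : 0 ≤ ∑ j ∈ a.assortment, Real.exp (I.utility t j (a.price j)) :=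
    Finset.sum_nonneg fun _ _ => (Real.exp_pos _).le
  linarith

lemma Instance.revenue_eq (I : Instance N d T) (t : Fin T) (a : Action N K) :
    I.revenue t a = (∑ i ∈ a.assortment, a.price i * Real.exp (I.utility t i (a.price i))) /
      (1 + ∑ j ∈ a.assortment, Real.exp (I.utility t j (a.price j))) := by
  rw [Instance.revenue, Finset.sum_div]
  refine Finset.sum_congr rfl fun i hi => ?_
  rw [Instance.choiceProb, if_pos hi, mul_div_assoc]

/-- With common price sensitivity `β`, the best revenue of an assortment of total attraction `Y` is
`r / β` where `r * exp r = Y / e`; this is the upper bound. -/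
lemma Instance.mul_revenue_le (I : Instance N d T) (t : Fin T) (a : Action N K) {β r : ℝ}
    (hβ : ∀ i, inner ℝ I.φ (I.x t i) = β) (hr : ∑ i ∈ a.assortment,
      Real.exp (inner ℝ I.ψ (I.x t i)) ≤ Real.exp 1 * (r * Real.exp r)) :
    β * I.revenue t a ≤ r := by
  rw [I.revenue_eq, ← mul_div_assoc, div_le_iff₀ (I.one_add_sum_exp_pos t a)]
  have key : ∀ i ∈ a.assortment,
      β * (a.price i * Real.exp (I.utility t i (a.price i))) ≤
        r * Real.exp (I.utility t i (a.price i)) +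
          Real.exp (-r - 1) * Real.exp (inner ℝ I.ψ (I.x t i)) := by
    intro i _
    -- `y + 1 ≤ exp y` at `y = β * price - r - 1`; equality holds at the optimal price `(r + 1) / β`.
    have h1 := Real.add_one_le_exp (β * a.price i - r - 1)
    have h2 := mul_le_mul_of_nonneg_right h1 (Real.exp_pos (I.utility t i (a.price i))).le
    rw [← Real.exp_add] at h2
    rw [← Real.exp_add]
    have h3 : β * a.price i - r - 1 + I.utility t i (a.price i) =
        -r - 1 + inner ℝ I.ψ (I.x t i) := by
      rw [Instance.utility, hβ]; ring
    rw [h3] at h2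
    linarith
  have hsum := Finset.sum_le_sum key
  rw [← Finset.mul_sum, Finset.sum_add_distrib, ← Finset.mul_sum, ← Finset.mul_sum] at hsum
  have h4 : Real.exp (-r - 1) * (Real.exp 1 * (r * Real.exp r)) = r := by
    have : Real.exp (-r - 1) * (Real.exp 1 * Real.exp r) = 1 := by
      rw [← Real.exp_add, ← Real.exp_add, Real.exp_eq_one_iff]; ring
    linear_combination r * this
  have h5 := mul_le_mul_of_nonneg_left hr (Real.exp_pos (-r - 1)).le
  rw [h4] at h5
  linarith

/-! ### Choice paths -/

/-- The history depends on the instance only through the features, and on the choices only through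
those of earlier rounds. -/
lemma Instance.history_congr {I I' : Instance N d T} (hx : I.x = I'.x) (π : Policy N d K T)
    {c c' : Fin T → Option (Fin N)} :
    ∀ (t : ℕ) (ht : t ≤ T), (∀ s : Fin T, (s : ℕ) < t → c s = c' s) →
      I.history π c t ht = I'.history π c' t ht
  | 0, _, _ => rfl
  | t + 1, ht, hc => by
      have ih := Instance.history_congr hx π t (Nat.le_of_succ_le ht)
        fun s hs => hc s (Nat.lt_succ_of_lt hs)
      simp only [Instance.history, ih, hx, hc ⟨t, ht⟩ (Nat.lt_succ_self t)]

lemma Instance.actionAt_congr {I I' : Instance N d T} (hx : I.x = I'.x) (π : Policy N d K T)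
    {c c' : Fin T → Option (Fin N)} {t : Fin T} (hc : ∀ s < t, c s = c' s) :
    I.actionAt π c t = I'.actionAt π c' t := by
  rw [Instance.actionAt, Instance.actionAt, hx,
    Instance.history_congr hx π t t.isLt.le fun s hs => hc s hs]

lemma snoc_causal {X : Type*} {w : Fin (T + 1) → (Fin (T + 1) → X) → ℝ}
    (hw : ∀ t c c', (∀ s ≤ t, c s = c' s) → w t c = w t c') (x₀ : X) (t : Fin T)
    (c c' : Fin T → X) (hc : ∀ s ≤ t, c s = c' s) :
    w t.castSucc (Fin.snoc (α := fun _ => X) c x₀) =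
      w t.castSucc (Fin.snoc (α := fun _ => X) c' x₀) := by
  refine hw _ _ _ fun s hs => ?_
  have hs' : s ≠ Fin.last T := ne_of_lt (lt_of_le_of_lt hs (Fin.castSucc_lt_last t))
  obtain ⟨s, rfl⟩ := Fin.exists_castSucc_eq.2 hs'
  simpa using hc s (by simpa using hs)

section Causal

variable {X : Type*} [Fintype X] [Nonempty X]

/-- Summing out the last coordinate of a product of causal weights: the weight of round `t` may
depend on the path up to and including `t`. -/
lemma exists_sum_prod_succ_eq (w : Fin (T + 1) → (Fin (T + 1) → X) → ℝ)
    (hw : ∀ t c c', (∀ s ≤ t, c s = c' s) → w t c = w t c') :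
    ∃ x₀ : X, ∑ c, ∏ t, w t c =
      ∑ c : Fin T → X, (∏ t : Fin T, w t.castSucc (Fin.snoc (α := fun _ => X) c x₀)) *
        ∑ x, w (Fin.last T)
          (Function.update (Fin.snoc (α := fun _ => X) c x₀) (Fin.last T) x) := by
  obtain ⟨x₀⟩ := ‹Nonempty X›
  refine ⟨x₀, ?_⟩
  rw [← (Fin.snocEquiv fun _ => X).sum_comp, Fintype.sum_prod_type_right]
  refine Finset.sum_congr rfl fun c _ => ?_
  rw [Finset.mul_sum]
  refine Finset.sum_congr rfl fun x _ => ?_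
  rw [Fin.prod_univ_castSucc, Fin.update_snoc_last]
  refine congrArg₂ (· * ·) ?_ rfl
  refine Finset.prod_congr rfl fun t _ => hw _ _ _ fun s hs => ?_
  have hs' : s ≠ Fin.last T := ne_of_lt (lt_of_le_of_lt hs (Fin.castSucc_lt_last t))
  obtain ⟨s, rfl⟩ := Fin.exists_castSucc_eq.2 hs'
  simp [Fin.snocEquiv]

/-- Tensorization under adaptivity: if every conditional sum is at least `ρ`, then the sum over all
paths is at least `ρ ^ T`. -/
lemma pow_le_sum_prod {ρ : ℝ} (hρ : 0 ≤ ρ) : ∀ {T : ℕ} (w : Fin T → (Fin T → X) → ℝ),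
    (∀ t c, 0 ≤ w t c) → (∀ t c c', (∀ s ≤ t, c s = c' s) → w t c = w t c') →
    (∀ t c, ρ ≤ ∑ x, w t (Function.update c t x)) → ρ ^ T ≤ ∑ c, ∏ t, w t c
  | 0, w, _, _, _ => by simp
  | T + 1, w, h0, hw, h => by
      obtain ⟨x₀, hx₀⟩ := exists_sum_prod_succ_eq w hw
      have ih := pow_le_sum_prod hρ
        (fun (t : Fin T) (c : Fin T → X) => w t.castSucc (Fin.snoc (α := fun _ => X) c x₀))
        (fun t c => h0 _ _) (snoc_causal hw x₀)
        (fun t c => by simpa only [Fin.snoc_update] using h t.castSucc (Fin.snoc c x₀))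
      rw [hx₀, pow_succ]
      calc ρ ^ T * ρ ≤ (∑ c : Fin T → X, ∏ t : Fin T,
            w t.castSucc (Fin.snoc (α := fun _ => X) c x₀)) * ρ :=
            mul_le_mul_of_nonneg_right ih hρ
        _ ≤ _ := by
            rw [Finset.sum_mul]
            exact Finset.sum_le_sum fun c _ => mul_le_mul_of_nonneg_left (h _ _)
              (Finset.prod_nonneg fun t _ => h0 _ _)

lemma sum_prod_eq_one : ∀ {T : ℕ} (w : Fin T → (Fin T → X) → ℝ),
    (∀ t c c', (∀ s ≤ t, c s = c' s) → w t c = w t c') →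
    (∀ t c, ∑ x, w t (Function.update c t x) = 1) → ∑ c, ∏ t, w t c = 1
  | 0, w, _, _ => by simp
  | T + 1, w, hw, h => by
      obtain ⟨x₀, hx₀⟩ := exists_sum_prod_succ_eq w hw
      have ih := sum_prod_eq_one
        (fun (t : Fin T) (c : Fin T → X) => w t.castSucc (Fin.snoc (α := fun _ => X) c x₀))
        (snoc_causal hw x₀)
        (fun t c => by simpa only [Fin.snoc_update] using h t.castSucc (Fin.snoc c x₀))
      simp only [hx₀, h, mul_one, ih]

end Causal

lemma Instance.choiceProb_nonneg (I : Instance N d T) (t : Fin T) (a : Action N K)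
    (o : Option (Fin N)) : 0 ≤ I.choiceProb t a o := by
  have := I.one_add_sum_exp_pos t a
  cases o with
  | none => simp only [Instance.choiceProb]; positivity
  | some i => simp only [Instance.choiceProb]; split_ifs <;> positivity

lemma Instance.sum_choiceProb (I : Instance N d T) (t : Fin T) (a : Action N K) :
    ∑ o, I.choiceProb t a o = 1 := by
  have := I.one_add_sum_exp_pos t a
  rw [Fintype.sum_option]
  simp only [Instance.choiceProb]
  rw [← Finset.sum_filter, Finset.filter_univ_mem, ← Finset.sum_div, ← add_div, div_self this.ne']

lemma Instance.pathProb_nonneg (I : Instance N d T) (π : Policy N d K T)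
    (c : Fin T → Option (Fin N)) : 0 ≤ I.pathProb π c :=
  Finset.prod_nonneg fun _ _ => I.choiceProb_nonneg _ _ _

lemma actionAt_update (I : Instance N d T) (π : Policy N d K T) (c : Fin T → Option (Fin N))
    (t : Fin T) (o : Option (Fin N)) :
    I.actionAt π (Function.update c t o) t = I.actionAt π c t :=
  Instance.actionAt_congr rfl π fun s hs => by simp [hs.ne]

lemma Instance.sum_pathProb (I : Instance N d T) (π : Policy N d K T) :
    ∑ c, I.pathProb π c = 1 := by
  refine sum_prod_eq_one (fun t c => I.choiceProb t (I.actionAt π c t) (c t))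
    (fun t c c' hc => ?_) fun t c => ?_
  · simp only [Instance.actionAt_congr rfl π fun s hs => hc s (le_of_lt hs), hc t le_rfl]
  · simp only [actionAt_update, Function.update_self, I.sum_choiceProb]

/-! ### Hellinger affinity -/

/-- A reverse Cauchy–Schwarz inequality: weights whose logarithms differ by at most `2 * δ` have
Hellinger affinity at least `1 / cosh δ`. -/
lemma sqrt_mul_le_cosh_mul_sum {ι : Type*} (s : Finset ι) (u u' : ι → ℝ) {δ : ℝ}
    (h : ∀ i ∈ s, |u i - u' i| ≤ 2 * δ) :
    √((∑ i ∈ s, Real.exp (u i)) * ∑ i ∈ s, Real.exp (u' i)) ≤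
      Real.cosh δ * ∑ i ∈ s, Real.exp ((u i + u' i) / 2) := by
  have key : ∀ i ∈ s, Real.exp (u i) + Real.exp (u' i) ≤
      2 * Real.cosh δ * Real.exp ((u i + u' i) / 2) := by
    intro i hi
    have h1 : Real.cosh ((u i - u' i) / 2) ≤ Real.cosh δ := by
      rw [Real.cosh_le_cosh, abs_div, abs_two]
      have := h i hi
      linarith [le_abs_self δ]
    have h2 : Real.exp (u i) + Real.exp (u' i) =
        2 * Real.cosh ((u i - u' i) / 2) * Real.exp ((u i + u' i) / 2) := by
      rw [Real.cosh_eq, mul_div_cancel₀ _ (two_ne_zero), add_mul, ← Real.exp_add, ← Real.exp_add]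
      ring_nf
    rw [h2]
    gcongr
  have hsum := Finset.sum_le_sum key
  rw [Finset.sum_add_distrib, ← Finset.mul_sum] at hsum
  have hA : 0 ≤ ∑ i ∈ s, Real.exp (u i) := Finset.sum_nonneg fun _ _ => (Real.exp_pos _).le
  have hB : 0 ≤ ∑ i ∈ s, Real.exp (u' i) := Finset.sum_nonneg fun _ _ => (Real.exp_pos _).le
  refine Real.sqrt_le_iff.2 ⟨by nlinarith, ?_⟩
  nlinarith [sq_nonneg (∑ i ∈ s, Real.exp (u i) - ∑ i ∈ s, Real.exp (u' i))]

lemma Instance.exp_le_sum_sqrt_choiceProb (I I' : Instance N d T) (t : Fin T) (a : Action N K)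
    {δ : ℝ} (hδ : 0 ≤ δ) (h : ∀ i p, |I.utility t i p - I'.utility t i p| ≤ 2 * δ) :
    Real.exp (-(δ ^ 2 / 2)) ≤ ∑ o, √(I.choiceProb t a o * I'.choiceProb t a o) := by
  have hZ := I.one_add_sum_exp_pos t a
  have hZ' := I'.one_add_sum_exp_pos t a
  -- The no-purchase option is an alternative of utility zero.
  have hcs := sqrt_mul_le_cosh_mul_sum (Finset.insertNone a.assortment)
    (fun o => o.elim 0 fun i => I.utility t i (a.price i))
    (fun o => o.elim 0 fun i => I'.utility t i (a.price i)) (δ := δ) (by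
      rintro (_ | i) _
      · simpa using hδ
      · exact h i _)
  simp only [Finset.sum_insertNone, Option.elim, Real.exp_zero, add_zero, zero_div] at hcs
  have hsum : ∑ o, √(I.choiceProb t a o * I'.choiceProb t a o) =
      (1 + ∑ i ∈ a.assortment,
        Real.exp ((I.utility t i (a.price i) + I'.utility t i (a.price i)) / 2)) /
      √((1 + ∑ j ∈ a.assortment, Real.exp (I.utility t j (a.price j))) *
        (1 + ∑ j ∈ a.assortment, Real.exp (I'.utility t j (a.price j)))) := by
    rw [Fintype.sum_option, add_div, Finset.sum_div]
    congr 1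
    · simp only [Instance.choiceProb]
      rw [div_mul_div_comm, one_mul, Real.sqrt_div zero_le_one, Real.sqrt_one]
    · rw [← Finset.sum_subset (Finset.subset_univ a.assortment) fun i _ hi => by
        simp [Instance.choiceProb, hi]]
      refine Finset.sum_congr rfl fun i hi => ?_
      simp only [Instance.choiceProb, if_pos hi]
      rw [div_mul_div_comm, ← Real.exp_add, Real.sqrt_div (Real.exp_pos _).le, Real.exp_half]
  rw [hsum, le_div_iff₀ (Real.sqrt_pos.2 (mul_pos hZ hZ'))]
  have hM : 0 ≤ 1 + ∑ i ∈ a.assortment,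
        Real.exp ((I.utility t i (a.price i) + I'.utility t i (a.price i)) / 2) :=
    add_nonneg zero_le_one (Finset.sum_nonneg fun _ _ => (Real.exp_pos _).le)
  have h1 := hcs.trans (mul_le_mul_of_nonneg_right (Real.cosh_le_exp_half_sq δ) hM)
  have h2 := mul_le_mul_of_nonneg_left h1 (Real.exp_pos (-(δ ^ 2 / 2))).le
  rwa [← mul_assoc, ← Real.exp_add, neg_add_cancel, Real.exp_zero, one_mul] at h2

/-- Le Cam's inequality between the affinity of two probability vectors and their overlap. -/
lemma sq_sum_sqrt_mul_le {ι : Type*} (s : Finset ι) {P Q : ι → ℝ} (hP : ∀ i, 0 ≤ P i)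
    (hQ : ∀ i, 0 ≤ Q i) (hP1 : ∑ i ∈ s, P i = 1) (hQ1 : ∑ i ∈ s, Q i = 1) :
    (∑ i ∈ s, √(P i * Q i)) ^ 2 ≤ 2 * ∑ i ∈ s, min (P i) (Q i) := by
  have h1 : (∑ i ∈ s, √(P i * Q i)) ^ 2 ≤
      (∑ i ∈ s, min (P i) (Q i)) * ∑ i ∈ s, max (P i) (Q i) := by
    refine Finset.sum_sq_le_sum_mul_sum_of_sq_le_mul s
      (fun i _ => le_min (hP i) (hQ i)) (fun i _ => (hP i).trans (le_max_left _ _)) fun i _ => ?_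
    exact (Real.sq_sqrt (mul_nonneg (hP i) (hQ i))).trans_le (min_mul_max _ _).ge
  have h2 : ∑ i ∈ s, max (P i) (Q i) ≤ 2 := by
    calc _ ≤ ∑ i ∈ s, (P i + Q i) :=
          Finset.sum_le_sum fun i _ => max_le_add_of_nonneg (hP i) (hQ i)
      _ = 2 := by rw [Finset.sum_add_distrib, hP1, hQ1]; norm_num
  have h3 : 0 ≤ ∑ i ∈ s, min (P i) (Q i) := Finset.sum_nonneg fun i _ => le_min (hP i) (hQ i)
  nlinarith

/-- Two instances whose utilities differ by at most `2 * δ` induce path laws that overlap in mass at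
least `exp (-(T * δ ^ 2)) / 2`, whatever the policy. -/
lemma Instance.exp_le_sum_min_pathProb {I I' : Instance N d T} (hx : I.x = I'.x)
    (π : Policy N d K T) {δ : ℝ} (hδ : 0 ≤ δ)
    (h : ∀ t i p, |I.utility t i p - I'.utility t i p| ≤ 2 * δ) :
    Real.exp (-(T * δ ^ 2)) / 2 ≤ ∑ c, min (I.pathProb π c) (I'.pathProb π c) := by
  have haff : Real.exp (-(δ ^ 2 / 2)) ^ T ≤ ∑ c, √(I.pathProb π c * I'.pathProb π c) := by
    have heq : ∀ c, √(I.pathProb π c * I'.pathProb π c) =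
        ∏ t, √(I.choiceProb t (I.actionAt π c t) (c t) *
          I'.choiceProb t (I.actionAt π c t) (c t)) := by
      intro c
      rw [Instance.pathProb, Instance.pathProb, ← Finset.prod_mul_distrib,
        Real.sqrt_prod _ fun t _ => mul_nonneg (I.choiceProb_nonneg _ _ _)
          (I'.choiceProb_nonneg _ _ _)]
      simp only [← Instance.actionAt_congr hx π (c := c) fun s _ => rfl]
    simp only [heq]
    refine pow_le_sum_prod (Real.exp_pos _).le
      (fun t c => √(I.choiceProb t (I.actionAt π c t) (c t) *
          I'.choiceProb t (I.actionAt π c t) (c t))) (fun t c => Real.sqrt_nonneg _)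
      (fun t c c' hc => ?_) fun t c => ?_
    · simp only [Instance.actionAt_congr rfl π fun s hs => hc s (le_of_lt hs), hc t le_rfl]
    · simp only [actionAt_update, Function.update_self]
      exact I.exp_le_sum_sqrt_choiceProb I' t _ hδ (h t)
  have hsq := sq_sum_sqrt_mul_le Finset.univ (I.pathProb_nonneg π) (I'.pathProb_nonneg π)
    (I.sum_pathProb π) (I'.sum_pathProb π)
  have hpow := pow_le_pow_left₀ (by positivity) haff 2
  have : (Real.exp (-(δ ^ 2 / 2)) ^ T) ^ 2 = Real.exp (-(T * δ ^ 2)) := by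
    rw [← Real.exp_nat_mul, ← Real.exp_nat_mul]; push_cast; ring_nf
  rw [this] at hpow
  linarith

/-! ### Assouad's averaging -/

/-- If flipping coordinate `j` of `v` pairs values of `g j` with sum at least `b`, then some `v`
attains at least the average `m * (b / 2)` of the sum over `j`. -/
lemma exists_sum_ge_of_flip (g : Fin m → (Fin m → Bool) → ℝ) {b : ℝ}
    (h : ∀ j v, b ≤ g j v + g j (Function.update v j (!v j))) :
    ∃ v, m * (b / 2) ≤ ∑ j, g j v := by
  have hj : ∀ j, ∑ _v : Fin m → Bool, b / 2 ≤ ∑ v, g j v := by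
    intro j
    have hinv : Function.Involutive fun v : Fin m → Bool => Function.update v j (!v j) := by
      intro v; simp
    have hflip : ∑ v, g j (Function.update v j (!v j)) = ∑ v, g j v :=
      Equiv.sum_comp hinv.toPerm (g j)
    have := Finset.sum_le_sum fun v (_ : v ∈ Finset.univ) => h j v
    rw [Finset.sum_add_distrib, hflip] at this
    rw [← Finset.sum_div]
    linarith
  have hsum := Finset.sum_le_sum fun j (_ : j ∈ Finset.univ) => hj j
  rw [Finset.sum_comm, Finset.sum_comm (f := fun j v => g j v)] at hsum
  obtain ⟨v, -, hv⟩ := Finset.exists_le_of_sum_le Finset.univ_nonempty hsum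
  exact ⟨v, by simpa using hv⟩

/-! ### The hard instances -/

/-- The sign `1` or `-1` encoded by a Boolean. -/
def sgn (b : Bool) : ℝ := if b then 1 else -1

lemma sgn_mul_sgn (b b' : Bool) : sgn b * sgn b' = 1 - 2 * if b' = b then 0 else 1 := by
  cases b <;> cases b' <;> norm_num [sgn]

/-- The vector with first coordinate `a` and the remaining ones `b` times the signs `s`. -/
def cubeVector (a b : ℝ) (s : Fin m → Bool) : Feature (m + 1) :=
  WithLp.toLp 2 (Fin.cons a fun j => b * sgn (s j))

lemma inner_cubeVector (a b a' b' : ℝ) (s s' : Fin m → Bool) :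
    inner ℝ (cubeVector a b s) (cubeVector a' b' s') =
      a * a' + b * b' * ∑ j, sgn (s j) * sgn (s' j) := by
  simp only [cubeVector, PiLp.inner_apply, Fin.sum_univ_succ, Fin.cons_zero, Fin.cons_succ,
    Finset.mul_sum, RCLike.inner_apply, conj_trivial]
  congr 1
  · ring
  · exact Finset.sum_congr rfl fun j _ => by ring

lemma norm_sq_cubeVector (a b : ℝ) (s : Fin m → Bool) :
    ‖cubeVector a b s‖ ^ 2 = a ^ 2 + m * b ^ 2 := by
  rw [← real_inner_self_eq_norm_sq, inner_cubeVector]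
  simp [sgn_mul_sgn]; ring

/-- The instance with hidden sign vector `v`. Item `i` carries the signs `lab i`; every item has
price sensitivity `L`, and intrinsic utility `δ` times the inner product of `v` and `lab i`. -/
def hardInstance (T : ℕ) (lab : Fin N → Fin m → Bool) (L δ : ℝ) (v : Fin m → Bool) :
    Instance N (m + 1) T where
  x _ i := cubeVector √L √δ (lab i)
  ψ := cubeVector 0 √δ v
  φ := cubeVector √L 0 v

/-- The fraction of the `K` slots of the assortment that are not filled by an item whose `j`-th sign
is `σ`; empty slots count as misses. -/
def missRate (lab : Fin N → Fin m → Bool) (a : Action N K) (j : Fin m) (σ : Bool) : ℝ :=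
  1 - ∑ i ∈ a.assortment, (if lab i j = σ then 1 else 0) / (K : ℝ)

section Hard

variable {lab : Fin N → Fin m → Bool} {L δ : ℝ}

lemma hardInstance_sensitivity (hL : 0 ≤ L) (v : Fin m → Bool) (t : Fin T) (i : Fin N) :
    inner ℝ (hardInstance T lab L δ v).φ ((hardInstance T lab L δ v).x t i) = L := by
  simp [hardInstance, inner_cubeVector, Real.mul_self_sqrt hL]

lemma hardInstance_intrinsic (hδ : 0 ≤ δ) (v : Fin m → Bool) (t : Fin T) (i : Fin N) :
    inner ℝ (hardInstance T lab L δ v).ψ ((hardInstance T lab L δ v).x t i) =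
      δ * m - 2 * δ * ∑ j, if lab i j = v j then 0 else 1 := by
  simp only [hardInstance, inner_cubeVector, Real.mul_self_sqrt hδ, sgn_mul_sgn,
    Finset.sum_sub_distrib, ← Finset.mul_sum]
  simp; ring

lemma hardInstance_admissible (hL : 0 ≤ L) (hδ : 0 ≤ δ) (hLδ : m * δ ≤ 1 - L)
    (v : Fin m → Bool) : (hardInstance T lab L δ v).Admissible L where
  norm_x_le t i := by
    refine (sq_le_one_iff₀ (norm_nonneg _)).1 ?_
    simp only [hardInstance]
    rw [norm_sq_cubeVector, Real.sq_sqrt hL, Real.sq_sqrt hδ]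
    linarith
  norm_param_le := by
    refine (sq_le_one_iff₀ (norm_nonneg _)).1 ?_
    rw [WithLp.prod_norm_sq_eq_of_L2]
    change ‖cubeVector 0 √δ v‖ ^ 2 + ‖cubeVector √L 0 v‖ ^ 2 ≤ 1
    rw [norm_sq_cubeVector, norm_sq_cubeVector, Real.sq_sqrt hL, Real.sq_sqrt hδ]
    linarith
  sensitivity t i := (hardInstance_sensitivity hL v t i).ge

lemma hardInstance_utility_sub (hL : 0 ≤ L) (hδ : 0 ≤ δ) (v : Fin m → Bool) (j : Fin m)
    (t : Fin T) (i : Fin N) (p : ℝ) :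
    |(hardInstance T lab L δ v).utility t i p -
      (hardInstance T lab L δ (Function.update v j (!v j))).utility t i p| ≤ 2 * δ := by
  simp only [Instance.utility, hardInstance_sensitivity hL, hardInstance_intrinsic hδ]
  have hrest : ∑ k ∈ Finset.univ.erase j,
        (if lab i k = Function.update v j (!v j) k then (0 : ℝ) else 1) =
      ∑ k ∈ Finset.univ.erase j, if lab i k = v k then (0 : ℝ) else 1 :=
    Finset.sum_congr rfl fun k hk => by rw [Function.update_of_ne (Finset.ne_of_mem_erase hk)]
  rw [← Finset.add_sum_erase _ _ (Finset.mem_univ j),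
    ← Finset.add_sum_erase _ (fun k => if lab i k = Function.update v j (!v j) k then (0 : ℝ)
      else 1) (Finset.mem_univ j), hrest, Function.update_self]
  cases lab i j <;> cases v j <;> simp <;> ring_nf <;> rw [abs_le] <;> constructor <;> linarith

lemma one_le_missRate_add (hK : 0 < K) (a : Action N K) (j : Fin m) (σ : Bool) :
    1 ≤ missRate lab a j σ + missRate lab a j (!σ) := by
  have hK' : (0 : ℝ) < K := by exact_mod_cast hK
  have h : ∑ i ∈ a.assortment, (if lab i j = σ then (1 : ℝ) else 0) / (K : ℝ) +
      ∑ i ∈ a.assortment, (if lab i j = !σ then (1 : ℝ) else 0) / (K : ℝ) =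
      a.assortment.card / K := by
    rw [← Finset.sum_add_distrib, div_eq_mul_inv, ← nsmul_eq_mul]
    refine Finset.sum_eq_card_nsmul fun i _ => ?_
    cases lab i j <;> cases σ <;> simp
  have hcard : (a.assortment.card : ℝ) / K ≤ 1 := by
    rw [div_le_one hK']; exact_mod_cast a.card_le
  simp only [missRate]
  linarith

lemma missRate_nonneg (hK : 0 < K) (a : Action N K) (j : Fin m) (σ : Bool) :
    0 ≤ missRate lab a j σ := by
  have hK' : (0 : ℝ) < K := by exact_mod_cast hK
  have h : ∑ i ∈ a.assortment, (if lab i j = σ then (1 : ℝ) else 0) / (K : ℝ) ≤ 1 := by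
    calc _ ≤ ∑ i ∈ a.assortment, 1 / (K : ℝ) := by
          refine Finset.sum_le_sum fun i _ => ?_
          gcongr
          split_ifs <;> norm_num
      _ = a.assortment.card / K := by rw [Finset.sum_const, nsmul_eq_mul, mul_one_div]
      _ ≤ 1 := by rw [div_le_one hK']; exact_mod_cast a.card_le
  simp only [missRate]
  linarith

/-- The total attraction of an assortment, relative to `K` items that match all signs of `v`. -/
lemma sum_exp_intrinsic_le (hK : 0 < K) (hδ : 0 ≤ δ) (hmδ : 2 * (m * δ) ≤ 1) (v : Fin m → Bool)
    (t : Fin T) (a : Action N K) :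
    ∑ i ∈ a.assortment,
        Real.exp (inner ℝ (hardInstance T lab L δ v).ψ ((hardInstance T lab L δ v).x t i)) ≤
      (1 - δ * ∑ j, missRate lab a j (v j)) * (K * Real.exp (δ * m)) := by
  have hK' : (0 : ℝ) < K := by exact_mod_cast hK
  set n : Fin N → ℝ := fun i => ∑ j, if lab i j = v j then 1 else 0 with hn
  have hwrong : ∀ i, (∑ j, if lab i j = v j then (0 : ℝ) else 1) = m - n i := by
    intro i
    rw [eq_sub_iff_add_eq, hn, ← Finset.sum_add_distrib]
    calc _ = ∑ _j : Fin m, (1 : ℝ) := Finset.sum_congr rfl fun j _ => by split_ifs <;> simp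
      _ = m := by simp
  have hn0 : ∀ i, 0 ≤ n i := fun i => Finset.sum_nonneg fun j _ => by split_ifs <;> norm_num
  have hnm : ∀ i, 0 ≤ m - n i := fun i => by
    rw [← hwrong]; exact Finset.sum_nonneg fun j _ => by split_ifs <;> norm_num
  have hterm : ∀ i ∈ a.assortment,
      Real.exp (inner ℝ (hardInstance T lab L δ v).ψ ((hardInstance T lab L δ v).x t i)) ≤
        (1 - δ * m + δ * n i) * Real.exp (δ * m) := by
    intro i _
    rw [hardInstance_intrinsic hδ, hwrong, sub_eq_add_neg, Real.exp_add, mul_comm]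
    refine mul_le_mul_of_nonneg_right ?_ (Real.exp_pos _).le
    set z := 2 * δ * (m - n i) with hz
    have hz0 : 0 ≤ z := mul_nonneg (by linarith) (hnm i)
    have hz1 : z ≤ 1 := by nlinarith [mul_nonneg hδ (hn0 i)]
    have h1 : Real.exp (-z) ≤ 1 - z / 2 := by
      rw [Real.exp_neg, inv_le_comm₀ (Real.exp_pos z) (by linarith)]
      refine le_trans ?_ (Real.add_one_le_exp z)
      rw [inv_le_iff_one_le_mul₀ (by linarith)]
      nlinarith
    linarith
  have hmiss : ∑ j, missRate lab a j (v j) = m - (∑ i ∈ a.assortment, n i) / K := by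
    simp only [missRate, Finset.sum_sub_distrib, hn]
    rw [Finset.sum_comm, Finset.sum_div, Finset.sum_const, Finset.card_univ, Fintype.card_fin,
      nsmul_eq_mul, mul_one]
    simp only [Finset.sum_div]
  have hcard : (a.assortment.card : ℝ) ≤ K := by exact_mod_cast a.card_le
  refine (Finset.sum_le_sum hterm).trans ?_
  rw [← Finset.sum_mul, Finset.sum_add_distrib, ← Finset.mul_sum, Finset.sum_const, nsmul_eq_mul,
    hmiss, ← mul_assoc]
  refine mul_le_mul_of_nonneg_right ?_ (Real.exp_pos _).le
  have h2 : (1 - δ * (m - (∑ i ∈ a.assortment, n i) / K)) * K =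
      K * (1 - δ * m) + δ * ∑ i ∈ a.assortment, n i := by
    field_simp; ring
  rw [h2]
  have := mul_le_mul_of_nonneg_right hcard (by linarith : 0 ≤ 1 - δ * m)
  linarith

/-- An optimal action offers the `K` items that carry the signs `v`, and every action loses an
amount proportional to its misses. -/
lemma exists_optimal_hardInstance (hK : 0 < K) (hL : 0 < L) (hδ : 0 ≤ δ) (hmδ : 2 * (m * δ) ≤ 1)
    (v : Fin m → Bool) (hlab : (Finset.univ.filter fun i => lab i = v).card = K) :
    ∃ best : Action N K, ∀ (t : Fin T) (a : Action N K),
      δ / (6 * L) * ∑ j, missRate lab a j (v j) ≤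
        (hardInstance T lab L δ v).revenue t best - (hardInstance T lab L δ v).revenue t a := by
  have hK1 : (1 : ℝ) ≤ K := by exact_mod_cast hK
  obtain ⟨x, hx0, hx⟩ := exists_mul_exp_eq
    (c := K * Real.exp (δ * m - 1)) (by positivity)
  -- `x ≥ 1 / 5` since `exp (1 / 5) / 5 < exp (-1)`, so that `x / (1 + x) ≥ 1 / 6`.
  have hx5 : 1 / 5 ≤ x := by
    by_contra! hlt
    have h1 : x * Real.exp x ≤ 1 / 5 * Real.exp (1 / 5) := by gcongr
    have h2 : Real.exp (-1) ≤ K * Real.exp (δ * m - 1) := by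
      have : Real.exp (-1) ≤ Real.exp (δ * m - 1) :=
        Real.exp_le_exp.2 (by have := mul_nonneg hδ (Nat.cast_nonneg (α := ℝ) m); linarith)
      nlinarith [Real.exp_pos (δ * m - 1)]
    have h3 : Real.exp (6 / 5) < 5 := by
      have h5 : Real.exp (6 / 5) ^ 5 < 5 ^ 5 := by
        rw [← Real.exp_nat_mul]
        have : ((5 : ℕ) : ℝ) * (6 / 5) = ((6 : ℕ) : ℝ) * 1 := by norm_num
        rw [this, Real.exp_nat_mul]
        calc Real.exp 1 ^ 6 < 3 ^ 6 := by
              gcongr; exact Real.exp_one_lt_three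
          _ < 5 ^ 5 := by norm_num
      exact lt_of_pow_lt_pow_left₀ 5 (by norm_num) h5
    have h4 : Real.exp (6 / 5) * Real.exp (-1) = Real.exp (1 / 5) := by
      rw [← Real.exp_add]; norm_num
    nlinarith [Real.exp_pos (-1)]
  have hxK : Real.exp 1 * (x * Real.exp x) = K * Real.exp (δ * m) := by
    rw [hx, mul_left_comm, ← Real.exp_add]; ring_nf
  refine ⟨⟨Finset.univ.filter fun i => lab i = v, hlab.le, fun _ => (1 + x) / L⟩, fun t a => ?_⟩
  have hrev : (hardInstance T lab L δ v).revenue t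
      (⟨Finset.univ.filter fun i => lab i = v, hlab.le, fun _ => (1 + x) / L⟩ : Action N K) =
        x / L := by
    have hw : ∀ i ∈ Finset.univ.filter (fun i => lab i = v),
        Real.exp ((hardInstance T lab L δ v).utility t i ((1 + x) / L)) = x / K := by
      intro i hi
      have hi' : lab i = v := (Finset.mem_filter.1 hi).2
      rw [Instance.utility, hardInstance_sensitivity hL.le, hardInstance_intrinsic hδ, hi',
        mul_div_cancel₀ _ hL.ne', eq_div_iff (by positivity)]
      have : Real.exp (δ * m - 2 * δ * (∑ j, if v j = v j then (0 : ℝ) else 1) - (1 + x)) =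
          Real.exp (δ * m - 1) * Real.exp (-x) := by
        rw [← Real.exp_add]; simp; ring
      rw [this, mul_right_comm, mul_comm (Real.exp _) (K : ℝ), ← hx, mul_assoc, ← Real.exp_add]
      simp
    rw [Instance.revenue_eq]
    simp only
    rw [Finset.sum_congr rfl hw, ← Finset.mul_sum, Finset.sum_congr rfl hw, Finset.sum_const, hlab,
      nsmul_eq_mul]
    have : 1 + x ≠ 0 := by positivity
    field_simp
  rw [hrev]
  set M := ∑ j, missRate lab a j (v j) with hM
  have hM0 : 0 ≤ M := Finset.sum_nonneg fun j _ => missRate_nonneg hK a j _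
  have hMm : M ≤ m := by
    calc M ≤ ∑ _j : Fin m, (1 : ℝ) := Finset.sum_le_sum fun j _ => by
          rw [missRate, sub_le_self_iff]
          exact Finset.sum_nonneg fun i _ => by split_ifs <;> positivity
      _ = m := by simp
  have hδM0 : 0 ≤ δ * M := mul_nonneg hδ hM0
  have hδM1 : δ * M ≤ 1 := by nlinarith
  have hle := sum_exp_intrinsic_le (L := L) (lab := lab) hK hδ hmδ v t a
  have hq6 : 1 / 6 ≤ x / (1 + x) := by
    rw [div_le_div_iff₀ (by norm_num) (by positivity)]; linarith
  have hbound : L * (hardInstance T lab L δ v).revenue t a ≤ x - δ * M * (x / (1 + x)) := by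
    refine Instance.mul_revenue_le _ t a (hardInstance_sensitivity hL.le v t) (hle.trans ?_)
    rw [← hM, ← hxK, mul_left_comm]
    refine mul_le_mul_of_nonneg_left ?_ (Real.exp_pos 1).le
    have := mul_mul_exp_le (ρ := 1 - δ * M) hx0 (by linarith)
    simpa only [sub_sub_cancel] using this
  have h6 := mul_le_mul_of_nonneg_left hq6 hδM0
  have hR : (hardInstance T lab L δ v).revenue t a ≤ (x - δ * M * (x / (1 + x))) / L := by
    rw [le_div_iff₀ hL]; linarith
  calc δ / (6 * L) * M = (δ * M * (1 / 6)) / L := by field_simp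
    _ ≤ (δ * M * (x / (1 + x))) / L := by gcongr
    _ = x / L - (x - δ * M * (x / (1 + x))) / L := by ring
    _ ≤ _ := by linarith

/-- For a pair of instances that differ in one hidden sign, the expected numbers of misses in that
coordinate cannot both be small. -/
lemma misses_add_misses_flip_ge (hK : 0 < K) (hL : 0 ≤ L) (hδ : 0 ≤ δ)
    (π : Policy N (m + 1) K T) (j : Fin m) (v : Fin m → Bool) :
    T * (Real.exp (-(T * δ ^ 2)) / 2) ≤
      (∑ c, (hardInstance T lab L δ v).pathProb π c *
        ∑ t, missRate lab ((hardInstance T lab L δ v).actionAt π c t) j (v j)) +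
      ∑ c, (hardInstance T lab L δ (Function.update v j (!v j))).pathProb π c *
        ∑ t, missRate lab ((hardInstance T lab L δ (Function.update v j (!v j))).actionAt π c t) j
          (Function.update v j (!v j) j) := by
  set I := hardInstance T lab L δ v
  set I' := hardInstance T lab L δ (Function.update v j (!v j))
  have hx : I.x = I'.x := rfl
  have hact : ∀ c t, I'.actionAt π c t = I.actionAt π c t := fun c t =>
    Instance.actionAt_congr hx.symm π fun _ _ => rfl
  simp only [hact, Function.update_self]
  have hmin := Instance.exp_le_sum_min_pathProb hx π hδ
    fun t i p => hardInstance_utility_sub hL hδ v j t i p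
  rw [← Finset.sum_add_distrib]
  refine (mul_le_mul_of_nonneg_left hmin (Nat.cast_nonneg T)).trans ?_
  rw [Finset.mul_sum]
  refine Finset.sum_le_sum fun c _ => ?_
  set F := ∑ t, missRate lab (I.actionAt π c t) j (v j)
  set F' := ∑ t, missRate lab (I.actionAt π c t) j (!v j)
  have hF : 0 ≤ F := Finset.sum_nonneg fun t _ => missRate_nonneg hK _ _ _
  have hF' : 0 ≤ F' := Finset.sum_nonneg fun t _ => missRate_nonneg hK _ _ _
  have hFF : (T : ℝ) ≤ F + F' := by
    rw [← Finset.sum_add_distrib]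
    calc (T : ℝ) = ∑ _t : Fin T, (1 : ℝ) := by simp
      _ ≤ _ := Finset.sum_le_sum fun t _ => one_le_missRate_add hK _ _ _
  have hp : 0 ≤ min (I.pathProb π c) (I'.pathProb π c) :=
    le_min (I.pathProb_nonneg π c) (I'.pathProb_nonneg π c)
  calc _ ≤ (F + F') * min (I.pathProb π c) (I'.pathProb π c) :=
        mul_le_mul_of_nonneg_right hFF hp
    _ = min (I.pathProb π c) (I'.pathProb π c) * F +
        min (I.pathProb π c) (I'.pathProb π c) * F' := by ring
    _ ≤ _ := add_le_add (mul_le_mul_of_nonneg_right (min_le_left _ _) hF)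
        (mul_le_mul_of_nonneg_right (min_le_right _ _) hF')

/-- Every policy has regret of order `δ * m * T / L` on some hard instance, as long as `T * δ ^ 2`
is bounded. -/
lemma exists_hardInstance_regret_ge (hK : 0 < K) (hL : 0 < L) (hδ : 0 ≤ δ)
    (hmδ : 2 * (m * δ) ≤ 1) (hLδ : m * δ ≤ 1 - L)
    (hlab : ∀ v, (Finset.univ.filter fun i => lab i = v).card = K) (π : Policy N (m + 1) K T) :
    ∃ (I : Instance N (m + 1) T) (best : Fin T → Action N K),
      I.Admissible L ∧ (∀ t, I.IsOptimal t (best t)) ∧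
        δ / (6 * L) * (m * (T * (Real.exp (-(T * δ ^ 2)) / 2) / 2)) ≤ I.regret best π := by
  obtain ⟨v, hv⟩ := exists_sum_ge_of_flip
    (fun j v => ∑ c, (hardInstance T lab L δ v).pathProb π c *
        ∑ t, missRate lab ((hardInstance T lab L δ v).actionAt π c t) j (v j))
    fun j v => misses_add_misses_flip_ge hK hL.le hδ π j v
  obtain ⟨best, hbest⟩ := exists_optimal_hardInstance (T := T) hK hL hδ hmδ v (hlab v)
  refine ⟨hardInstance T lab L δ v, fun _ => best,
    hardInstance_admissible hL.le hδ hLδ v, fun t b => ?_, ?_⟩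
  · have h0 : 0 ≤ δ / (6 * L) * ∑ j, missRate lab b j (v j) :=
      mul_nonneg (by positivity) (Finset.sum_nonneg fun j _ => missRate_nonneg hK b j _)
    linarith [hbest t b]
  · refine (mul_le_mul_of_nonneg_left hv (by positivity)).trans ?_
    rw [Instance.regret, Finset.sum_comm (s := (Finset.univ : Finset (Fin m))), Finset.mul_sum]
    refine Finset.sum_le_sum fun c _ => ?_
    rw [← Finset.mul_sum, mul_left_comm]
    refine mul_le_mul_of_nonneg_left ?_ (Instance.pathProb_nonneg _ π c)
    rw [Finset.sum_comm (s := (Finset.univ : Finset (Fin m))), Finset.mul_sum,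
      ← Finset.sum_sub_distrib]
    exact Finset.sum_le_sum fun t _ => hbest t _

end Hard

/-- `K` copies of each sign vector. -/
lemma exists_balanced_labelling (K m : ℕ) :
    ∃ lab : Fin (K * 2 ^ m) → Fin m → Bool,
      ∀ v, (Finset.univ.filter fun i => lab i = v).card = K := by
  have e : Fin (K * 2 ^ m) ≃ Fin K × (Fin m → Bool) :=
    Fintype.equivOfCardEq (by simp)
  refine ⟨fun i => (e i).2, fun v => ?_⟩
  have h : (Finset.univ.filter fun i => (e i).2 = v).card =
      ((Finset.univ : Finset (Fin K)) ×ˢ ({v} : Finset (Fin m → Bool))).card :=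
    Finset.card_bij (fun i _ => e i) (fun i hi => Finset.mem_product.2 (by simpa using hi))
      (fun _ _ _ _ h => e.injective h) fun p hp => ⟨e.symm p, by
        simpa using (Finset.mem_product.1 hp).2, by simp⟩
  rw [h]; simp

end

end AssortmentPricing

theorem theorem3 :
    ∃ c₁ c₂ C₃ : ℝ, 0 < c₁ ∧ 0 < c₂ ∧ 0 < C₃ ∧
      ∀ (L₀ : ℝ) (d : ℕ), 0 < L₀ → L₀ < 1 → 0 < d → 4 ∣ d →
        ∃ T₀ : ℕ, ∀ K : ℕ, 1 ≤ K →
          ∃ N : ℕ, c₁ * (K * 2 ^ d) ≤ (N : ℝ) ∧ (N : ℝ) ≤ c₂ * (K * 2 ^ d) ∧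
            ∀ T : ℕ, T₀ ≤ T → ∀ π : AssortmentPricing.Policy N d K T,
              ∃ (I : AssortmentPricing.Instance N d T)
                (best : Fin T → AssortmentPricing.Action N K),
                I.Admissible L₀ ∧ (∀ t, I.IsOptimal t (best t)) ∧
                  C₃ * (d * Real.sqrt T) / L₀ ≤ I.regret best π := by
  refine ⟨1 / 2, 1 / 2, 1 / 144, by norm_num, by norm_num, by norm_num, ?_⟩
  intro L d hL hL1 hd hd4
  obtain ⟨m, rfl⟩ : ∃ m, d = m + 1 := ⟨d - 1, by omega⟩
  have hm : (m : ℝ) + 1 ≤ 2 * m := by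
    have : m + 1 ≤ 2 * m := by omega
    exact_mod_cast this
  refine ⟨⌈(2 * m / (1 - L)) ^ 2⌉₊ + 1, fun K hK => ⟨K * 2 ^ m, ?_, ?_, fun T hT π => ?_⟩⟩
  · push_cast; rw [pow_succ]; linarith
  · push_cast; rw [pow_succ]; linarith
  have h1L : 0 < 1 - L := by linarith
  have hTpos : (0 : ℝ) < T := by exact_mod_cast (by omega : 0 < T)
  have hs : 0 < √(T : ℝ) := Real.sqrt_pos.2 hTpos
  have hsT : 2 * m / (1 - L) ≤ √(T : ℝ) := by
    refine Real.le_sqrt_of_sq_le ((Nat.le_ceil _).trans ?_)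
    exact_mod_cast (by omega : ⌈(2 * m / (1 - L)) ^ 2⌉₊ ≤ T)
  rw [div_le_iff₀ h1L] at hsT
  have hδ : 2 * (m * (1 / √(T : ℝ))) ≤ 1 - L := by
    rw [mul_one_div, ← mul_div_assoc, div_le_iff₀ hs]; linarith
  have hδ0 : 0 ≤ m * (1 / √(T : ℝ)) := by positivity
  obtain ⟨lab, hlab⟩ := AssortmentPricing.exists_balanced_labelling K m
  obtain ⟨I, best, hadm, hopt, hreg⟩ := AssortmentPricing.exists_hardInstance_regret_ge
    (δ := 1 / √(T : ℝ)) hK hL (by positivity) (by linarith) (by linarith) hlab π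
  refine ⟨I, best, hadm, hopt, le_trans ?_ hreg⟩
  have hT1 : (T : ℝ) * (1 / √(T : ℝ)) ^ 2 = 1 := by
    rw [div_pow, Real.sq_sqrt hTpos.le]; field_simp
  -- The constant: `exp (-1) / 24 ≥ 1 / 72`, and `m ≥ d / 2`.
  have hexp : 1 / 3 ≤ Real.exp (-1) := by
    rw [Real.exp_neg, one_div]
    exact inv_anti₀ (Real.exp_pos 1) Real.exp_one_lt_three.le
  rw [hT1]
  have hTs : (T : ℝ) = √(T : ℝ) * √(T : ℝ) := (Real.mul_self_sqrt hTpos.le).symm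
  have heq : 1 / √(T : ℝ) / (6 * L) * (m * (T * (Real.exp (-1) / 2) / 2)) =
      Real.exp (-1) / 24 * (m * √(T : ℝ)) / L := by
    rw [mul_comm (T : ℝ), hTs, Real.sqrt_mul_self hs.le]; field_simp; ring
  rw [heq]
  refine div_le_div_of_nonneg_right ?_ hL.le
  push_cast
  have h1 : ((m : ℝ) + 1) * √(T : ℝ) ≤ 2 * m * √(T : ℝ) := by gcongr
  have h2 : 1 / 3 * (m * √(T : ℝ)) ≤ Real.exp (-1) * (m * √(T : ℝ)) := by gcongr
  linarith
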